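/- Let $n\ge 0$ and let $U,V$ be unitary $2^n\times 2^n$ matrices; $U$ is the specification of an $n$-qubit computation and $V$ is the unitary of the quantum circuit $G$ that is meant to realize it. Let $\mathcal S_n$ be the set of global quantum stimuli, i.e. of all state vectors $|g\rangle=(G_0\cdots G_{l-1})|0\ldots0\rangle$ with $l>1$, where each $G_i$ is a layer of Clifford gates, that is, a product of Hadamard gates $H$, phase gates $S$ and $\mathrm{CNOT}$ gates acting on pairwise disjoint sets of the $n$ qubits. Let $\mathcal F(|\varphi\rangle,|\psi\rangle)=|\langle\varphi|\psi\rangle|^2$ denote the fidelity and let $$\mathcal F_{\mathrm{avg}}(U,V)=\frac{1+2^{-n}\,|\mathrm{tr}(U^\dagger V)|^2}{2^n+1}$$ be the average gate fidelity, where $\mathrm{tr}$ is the ordinary (unnormalized) trace. Then $\mathcal S_n$ is finite, and for $|g\rangle$ drawn uniformly at random from $\mathcal S_n$, $$\mathbb E_{|g\rangle}\,\mathcal F(U|g\rangle,V|g\rangle)=\mathcal F_{\mathrm{avg}}(U,V)\qquad\text{and}\qquad \Pr_{|g\rangle}\bigl[\mathcal F(U|g\rangle,V|g\rangle)=1\bigr]\le\mathcal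 F_{\mathrm{avg}}(U,V).$$ Moreover, $\mathcal F_{\mathrm{avg}}(U,V)=1$ if and only if $G$ correctly realizes $U$, i.e. $V=zU$ for some $z\in\mathbb C$ with $|z|=1$; otherwise $\mathcal F_{\mathrm{avg}}(U,V)<1$. -/

import Mathlib

open Matrix

noncomputable section

namespace QuantumStimuli

/-- Computational basis labels of an `n`-qubit system: `x q` is the value of qubit `q`. -/
abbrev Bits (n : ℕ) : Type := Fin n → Fin 2

/-- Vectors of `2 ^ n` complex amplitudes. -/
abbrev StateVector (n : ℕ) : Type := Bits n → ℂ

/-- Complex matrices of size `2 ^ n` by `2 ^ n`. -/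
abbrev QubitMatrix (n : ℕ) : Type := Matrix (Bits n) (Bits n) ℂ

/-- The computational basis state `|0…0⟩`. -/
def ketZero (n : ℕ) : StateVector n := Pi.single 0 1

/-- The Hadamard matrix. -/
def hadamard : Matrix (Fin 2) (Fin 2) ℂ :=
  ((Real.sqrt 2 : ℝ) : ℂ)⁻¹ • !![1, 1; 1, -1]

/-- The matrix of the phase gate. -/
def phaseGate : Matrix (Fin 2) (Fin 2) ℂ := !![1, 0; 0, Complex.I]

/-- The single-qubit matrix `A` on qubit `q`, tensored with the identity on all other qubits. -/
def onQubit {n : ℕ} (q : Fin n) (A : Matrix (Fin 2) (Fin 2) ℂ) : QubitMatrix n :=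
  Matrix.of fun x y => if ∀ j, j ≠ q → x j = y j then A (x q) (y q) else 0

/-- The controlled-NOT gate: it maps `|y⟩` to the basis state in which the target bit `y t` is
replaced by `y t + y c` modulo 2 (addition in `Fin 2`). -/
def cnot {n : ℕ} (c t : Fin n) : QubitMatrix n :=
  Matrix.of fun x y => if x = Function.update y t (y t + y c) then 1 else 0

/-- The elementary Clifford gates on `n` qubits. -/
inductive CliffordGate (n : ℕ) : Type
  | H (q : Fin n) : CliffordGate n
  | S (q : Fin n) : CliffordGate n
  | CNOT (c t : Fin n) (hct : c ≠ t) : CliffordGate n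

namespace CliffordGate

/-- The unitary matrix of a gate, extended to the whole system. -/
def toMatrix {n : ℕ} : CliffordGate n → QubitMatrix n
  | H q => onQubit q hadamard
  | S q => onQubit q phaseGate
  | CNOT c t _ => cnot c t

/-- The qubits on which a gate acts. -/
def qubits {n : ℕ} : CliffordGate n → Finset (Fin n)
  | H q => {q}
  | S q => {q}
  | CNOT c t _ => {c, t}

end CliffordGate

/-- A single layer of Clifford gates: gates acting on pairwise disjoint sets of qubits (qubits may
be idle). -/
structure CliffordLayer (n : ℕ) : Type where
  gates : List (CliffordGate n)
  disjoint : gates.Pairwise fun a b => Disjoint a.qubits b.qubits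

/-- The matrix of a layer; its gates commute, so their order in the list is irrelevant. -/
def CliffordLayer.toMatrix {n : ℕ} (L : CliffordLayer n) : QubitMatrix n :=
  (L.gates.map CliffordGate.toMatrix).prod

/-- The set of global quantum stimuli: all states `(G₀ ⋯ Gₗ₋₁) |0…0⟩` with `l > 1` layers `Gᵢ` of
Clifford gates. -/
def globalStimuli (n : ℕ) : Set (StateVector n) :=
  {g | ∃ l : ℕ, 1 < l ∧ ∃ G : Fin l → CliffordLayer n,
    g = (List.ofFn fun i => (G i).toMatrix).prod *ᵥ ketZero n}

/-- The fidelity `|⟨φ|ψ⟩|²` of two pure states. -/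
def fidelity {n : ℕ} (φ ψ : StateVector n) : ℝ := ‖star φ ⬝ᵥ ψ‖ ^ 2

/-- The distribution of a global quantum stimulus chosen uniformly at random. -/
def stimulusMeasure (n : ℕ) : MeasureTheory.Measure (StateVector n) :=
  ProbabilityTheory.uniformOn (globalStimuli n)

/-- The average gate fidelity, with the usual (unnormalized) trace. -/
def avgFidelity {n : ℕ} (U V : QubitMatrix n) : ℝ :=
  (1 + ‖(Uᴴ * V).trace‖ ^ 2 / 2 ^ n) / (2 ^ n + 1)

/-- `V` correctly realizes `U`: both have the same functionality, i.e. agree up to a (physically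
unobservable) global phase. -/
def CorrectlyRealizes {n : ℕ} (V U : QubitMatrix n) : Prop :=
  ∃ z : ℂ, ‖z‖ = 1 ∧ V = z • U

end QuantumStimuli

end

namespace QuantumStimuli

variable {n : ℕ}

/-! Put `W = Uᴴ * V` and expand it in Pauli operators with coefficients `c u`. The fidelity on `g`
is `|⟨g|W|g⟩|²`, so its mean over the stimuli involves only the correlations of pairs of Pauli
expectations. The stimuli form a finite set permuted by every gate, and gates permute Paulis up to
phase, so these correlations are Clifford invariant. Phases kill the off-diagonal ones
(`pauliCorrelation_eq_zero`). Transitivity on nonzero labels (`eq_of_clifford_invariant`) makes the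
diagonal ones equal away from `0`, and Parseval on each `g` gives their normalized value `1 / (2 ^ n
+ 1)` (`pauliCorrelation_self`). With `∑ |c u|² = 1` and `c 0 = tr W / 2 ^ n` the mean is the
average fidelity (`sum_stimuli_sq_norm_expectation`). The probability bound is Markov's inequality.
Fidelity one means that all Pauli weight of `W` sits on the identity. -/

/-! ### Characters of bit strings -/

/-- The sign `(-1) ^ (a b)`. -/
noncomputable def bitSign (a b : Fin 2) : ℂ := if a = 1 ∧ b = 1 then -1 else 1

lemma bitSign_zero_left (b : Fin 2) : bitSign 0 b = 1 := by simp [bitSign]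

lemma bitSign_zero_right (a : Fin 2) : bitSign a 0 = 1 := by simp [bitSign]

lemma bitSign_add_left (a b c : Fin 2) : bitSign (a + b) c = bitSign a c * bitSign b c := by
  fin_cases a <;> fin_cases b <;> fin_cases c <;> simp [bitSign]

lemma bitSign_add_right (a b c : Fin 2) : bitSign a (b + c) = bitSign a b * bitSign a c := by
  fin_cases a <;> fin_cases b <;> fin_cases c <;> simp [bitSign]

lemma bitSign_mul_self (a b : Fin 2) : bitSign a b * bitSign a b = 1 := by
  unfold bitSign; split_ifs <;> simp

lemma star_bitSign (a b : Fin 2) : star (bitSign a b) = bitSign a b := by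
  unfold bitSign; split_ifs <;> simp

lemma sum_bitSign_mul (b c : Fin 2) :
    ∑ k, bitSign k b * bitSign k c = if b = c then 2 else 0 := by
  fin_cases b <;> fin_cases c <;> norm_num [bitSign]

/-- The character `b ↦ (-1) ^ (z ⬝ b)`. -/
noncomputable def walsh (z b : Bits n) : ℂ := ∏ q, bitSign (z q) (b q)

lemma walsh_zero_left (b : Bits n) : walsh 0 b = 1 := by simp [walsh, bitSign_zero_left]

lemma walsh_add_left (z w b : Bits n) : walsh (z + w) b = walsh z b * walsh w b := by
  simp [walsh, bitSign_add_left, Finset.prod_mul_distrib]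

lemma walsh_add_right (z b c : Bits n) : walsh z (b + c) = walsh z b * walsh z c := by
  simp [walsh, bitSign_add_right, Finset.prod_mul_distrib]

lemma star_walsh (z b : Bits n) : star (walsh z b) = walsh z b := by
  unfold walsh
  rw [star_prod]
  exact Finset.prod_congr rfl fun q _ => star_bitSign _ _

lemma walsh_single_right (z : Bits n) (q : Fin n) (k : Fin 2) :
    walsh z (Pi.single q k) = bitSign (z q) k := by
  unfold walsh
  rw [Finset.prod_eq_single q]
  · simp
  · intro j _ hj; simp [hj, bitSign_zero_right]
  · simp

lemma walsh_single_left (b : Bits n) (q : Fin n) (k : Fin 2) :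
    walsh (Pi.single q k) b = bitSign k (b q) := by
  unfold walsh
  rw [Finset.prod_eq_single q]
  · simp
  · intro j _ hj; simp [hj, bitSign_zero_left]
  · simp

lemma sum_walsh_mul (b c : Bits n) :
    ∑ z, walsh z b * walsh z c = if b = c then 2 ^ n else 0 := by
  have h : ∀ z : Bits n, walsh z b * walsh z c =
      ∏ q, bitSign (z q) (b q) * bitSign (z q) (c q) := fun z => by
    simp [walsh, Finset.prod_mul_distrib]
  simp_rw [h]
  rw [← Fintype.prod_sum (fun q k => bitSign k (b q) * bitSign k (c q))]
  simp_rw [sum_bitSign_mul, Finset.prod_ite_zero, funext_iff]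
  simp

lemma sq_norm_eq_mul_star (w : ℂ) : ((‖w‖ ^ 2 : ℝ) : ℂ) = w * star w := by
  rw [Complex.star_def, Complex.mul_conj']; simp

/-- Parseval for the Walsh transform: expand the square and use orthogonality of characters. -/
lemma sum_sq_norm_walsh_transform (f : Bits n → ℂ) :
    ∑ z, ‖∑ b, walsh z b * f b‖ ^ 2 = 2 ^ n * ∑ b, ‖f b‖ ^ 2 := by
  apply Complex.ofReal_injective
  rw [Complex.ofReal_sum, Complex.ofReal_mul, Complex.ofReal_sum]
  simp_rw [sq_norm_eq_mul_star, star_sum, Finset.sum_mul_sum, star_mul, star_walsh]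
  rw [Finset.sum_comm, Finset.mul_sum]
  refine Finset.sum_congr rfl fun b _ => ?_
  rw [Finset.sum_comm]
  have h : ∀ c, ∑ z, walsh z b * f b * (star (f c) * walsh z c) =
      (if b = c then 2 ^ n else 0) * (f b * star (f c)) := fun c => by
    rw [← sum_walsh_mul, Finset.sum_mul]
    exact Finset.sum_congr rfl fun z _ => by ring
  simp_rw [h, ite_mul, zero_mul]
  simp

lemma bits_add_self (x : Bits n) : x + x = 0 := by
  funext j
  have : ∀ a : Fin 2, a + a = 0 := by decide
  exact this _

lemma bits_eq_add_iff {a b x : Bits n} : a = b + x ↔ b = a + x := by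
  constructor <;> rintro rfl <;> rw [add_assoc, bits_add_self, add_zero]

/-! ### Pauli expansion of matrices -/

/-- The Pauli operator `X ^ x Z ^ z` for `u = (x, z)`. -/
noncomputable def pauli (u : Bits n × Bits n) : QubitMatrix n :=
  Matrix.of fun a b => if a = b + u.1 then walsh u.2 b else 0

lemma mul_pauli_apply (M : QubitMatrix n) (u : Bits n × Bits n) (a b : Bits n) :
    (M * pauli u) a b = M a (b + u.1) * walsh u.2 b := by
  simp [Matrix.mul_apply, pauli]

lemma pauli_mul_apply (M : QubitMatrix n) (u : Bits n × Bits n) (a b : Bits n) :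
    (pauli u * M) a b = walsh u.2 (a + u.1) * M (a + u.1) b := by
  simp only [Matrix.mul_apply, pauli, Matrix.of_apply]
  simp_rw [bits_eq_add_iff (a := a)]
  simp

lemma pauli_zero : pauli (0 : Bits n × Bits n) = 1 := by
  ext a b
  simp [pauli, walsh_zero_left, Matrix.one_apply]

/-- The coefficients of a matrix in the basis of Pauli operators. -/
noncomputable def pauliCoeff (W : QubitMatrix n) (u : Bits n × Bits n) : ℂ :=
  (2 ^ n)⁻¹ * ∑ b, walsh u.2 b * W (b + u.1) b

lemma sum_pauliCoeff_smul (W : QubitMatrix n) : ∑ u, pauliCoeff W u • pauli u = W := by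
  ext a b
  simp only [Matrix.sum_apply, Matrix.smul_apply, smul_eq_mul, pauli, Matrix.of_apply,
    Fintype.sum_prod_type]
  -- Only the shift `x = a + b` takes `b` to `a`, as addition has characteristic two.
  rw [Finset.sum_eq_single (a + b)]
  · have h : a = b + (a + b) := by
      rw [← add_assoc, add_comm b a, add_assoc, bits_add_self, add_zero]
    rw [← h]
    simp only [if_true, pauliCoeff]
    have h2 : ∀ z : Bits n, ((2 ^ n)⁻¹ * ∑ c, walsh z c * W (c + (a + b)) c) * walsh z b =
        (2 ^ n)⁻¹ * ∑ c, walsh z c * walsh z b * W (c + (a + b)) c := fun z => by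
      rw [mul_assoc, Finset.sum_mul]
      congr 1
      exact Finset.sum_congr rfl fun c _ => by ring
    simp_rw [h2]
    rw [← Finset.mul_sum, Finset.sum_comm]
    simp_rw [← Finset.sum_mul, sum_walsh_mul, ite_mul, zero_mul]
    simp [← h]
  · intro x _ hx
    refine Finset.sum_eq_zero fun z _ => ?_
    rw [if_neg, mul_zero]
    rintro rfl
    apply hx
    rw [add_comm b x, add_assoc, bits_add_self, add_zero]
  · simp

lemma sum_sum_add_right (f : Bits n → Bits n → ℝ) :
    ∑ x, ∑ b, f (b + x) b = ∑ a, ∑ b, f a b := by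
  rw [Finset.sum_comm, Finset.sum_comm (f := f)]
  exact Finset.sum_congr rfl fun b _ => Equiv.sum_comp (Equiv.addLeft b) fun a => f a b

lemma sum_sq_norm_pauliCoeff (W : QubitMatrix n) :
    ∑ u, ‖pauliCoeff W u‖ ^ 2 = (2 ^ n)⁻¹ * ∑ a, ∑ b, ‖W a b‖ ^ 2 := by
  simp only [pauliCoeff, norm_mul, mul_pow, Fintype.sum_prod_type, ← Finset.mul_sum,
    sum_sq_norm_walsh_transform]
  rw [sum_sum_add_right fun a b => ‖W a b‖ ^ 2, ← mul_assoc]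
  congr 1
  simp
  field_simp

lemma pauliCoeff_zero (W : QubitMatrix n) : pauliCoeff W 0 = (2 ^ n)⁻¹ * W.trace := by
  simp [pauliCoeff, walsh_zero_left, Matrix.trace]

lemma sum_sq_norm_of_mem_unitaryGroup {W : QubitMatrix n}
    (hW : W ∈ Matrix.unitaryGroup (Bits n) ℂ) : ∑ a, ∑ b, ‖W a b‖ ^ 2 = 2 ^ n := by
  apply Complex.ofReal_injective
  simp_rw [Complex.ofReal_sum, sq_norm_eq_mul_star]
  have h : ∀ a, ∑ b, W a b * star (W a b) = 1 := fun a => by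
    have := congrFun (congrFun (Matrix.mem_unitaryGroup_iff.1 hW) a) a
    simpa [Matrix.mul_apply, Matrix.star_apply] using this
  rw [Finset.sum_congr rfl fun a _ => h a]
  simp

lemma sum_sq_norm_pauliCoeff_of_mem_unitaryGroup {W : QubitMatrix n}
    (hW : W ∈ Matrix.unitaryGroup (Bits n) ℂ) : ∑ u, ‖pauliCoeff W u‖ ^ 2 = 1 := by
  rw [sum_sq_norm_pauliCoeff, sum_sq_norm_of_mem_unitaryGroup hW]
  simp

/-! ### Expectations of Pauli operators -/

/-- The expectation value `⟨g|A|g⟩`. -/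
noncomputable def expectation (g : StateVector n) (A : QubitMatrix n) : ℂ := star g ⬝ᵥ (A *ᵥ g)

lemma expectation_pauli (g : StateVector n) (u : Bits n × Bits n) :
    expectation g (pauli u) = ∑ b, walsh u.2 b * (star (g (b + u.1)) * g b) := by
  simp only [expectation, dotProduct, Matrix.mulVec, pauli, Matrix.of_apply, Finset.mul_sum]
  rw [Finset.sum_comm]
  refine Finset.sum_congr rfl fun b _ => ?_
  simp
  ring

/-- For a fixed shift `x`, the expectations are the Walsh transform in `z` of `b ↦ star (g (b + x))
* g b`, so Parseval applies for each `x`. -/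
lemma sum_sq_norm_expectation_pauli (g : StateVector n) :
    ∑ u, ‖expectation g (pauli u)‖ ^ 2 = 2 ^ n * (∑ b, ‖g b‖ ^ 2) ^ 2 := by
  simp only [expectation_pauli, Fintype.sum_prod_type, sum_sq_norm_walsh_transform,
    ← Finset.mul_sum, norm_mul, norm_star, mul_pow]
  rw [sum_sum_add_right fun a b => ‖g a‖ ^ 2 * ‖g b‖ ^ 2, sq, Finset.sum_mul_sum]

lemma expectation_eq_sum (g : StateVector n) (W : QubitMatrix n) :
    expectation g W = ∑ u, pauliCoeff W u * expectation g (pauli u) := by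
  conv_lhs => rw [← sum_pauliCoeff_smul W]
  simp [expectation, Matrix.sum_mulVec, dotProduct_sum, Matrix.smul_mulVec]

lemma expectation_mulVec {M A B : QubitMatrix n} (hM : M ∈ Matrix.unitaryGroup (Bits n) ℂ)
    {ω : ℂ} (h : M * A = ω • (B * M)) (g : StateVector n) :
    expectation g A = ω * expectation (M *ᵥ g) B := by
  have h1 : Mᴴ * (M * A) = A := by
    rw [← Matrix.mul_assoc, ← Matrix.star_eq_conjTranspose, Matrix.mem_unitaryGroup_iff'.1 hM,
      Matrix.one_mul]
  rw [h] at h1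
  conv_lhs => rw [← h1]
  simp only [expectation, Matrix.star_mulVec, Matrix.mul_smul, Matrix.smul_mulVec, dotProduct_smul,
    smul_eq_mul, ← Matrix.mulVec_mulVec, Matrix.dotProduct_mulVec, Matrix.vecMul_vecMul]

/-! Gates act on the Pauli operators. -/

lemma onQubit_mulVec_apply (q : Fin n) (A : Matrix (Fin 2) (Fin 2) ℂ) (v : StateVector n)
    (a : Bits n) : (onQubit q A *ᵥ v) a = ∑ k, A (a q) k * v (Function.update a q k) := by
  simp only [Matrix.mulVec, dotProduct, onQubit, Matrix.of_apply]
  symm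
  apply Fintype.sum_of_injective (Function.update a q) (Function.update_injective a q)
  · intro c hc
    rw [if_neg, zero_mul]
    intro h
    exact hc ⟨c q, by
      funext j
      by_cases hj : j = q
      · subst hj; simp
      · simp [hj, h j hj]⟩
  · intro k
    rw [if_pos]
    · simp
    · intro j hj; simp [hj]

lemma onQubit_mul (q : Fin n) (A B : Matrix (Fin 2) (Fin 2) ℂ) :
    onQubit q A * onQubit q B = onQubit q (A * B) := by
  ext a b
  have h := onQubit_mulVec_apply q A (fun c => onQubit q B c b) a
  have h2 : (onQubit q A * onQubit q B) a b = (onQubit q A *ᵥ fun c => onQubit q B c b) a := rfl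
  have h3 : ∀ k, (∀ j, j ≠ q → Function.update a q k j = b j) ↔ (∀ j, j ≠ q → a j = b j) :=
    fun k => forall₂_congr fun j hj => by simp [hj]
  rw [h2, h]
  simp only [onQubit, Matrix.of_apply, h3, Matrix.mul_apply, Function.update_self]
  split_ifs <;> simp

lemma onQubit_one (q : Fin n) : onQubit q 1 = 1 := by
  ext a b
  simp only [onQubit, Matrix.of_apply, Matrix.one_apply]
  by_cases h : a = b
  · simp [h]
  · rw [if_neg h]
    split_ifs with h1 h2
    · exact absurd (funext fun j => by by_cases hj : j = q; exacts [hj ▸ h2, h1 j hj]) h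
    · rfl
    · rfl

lemma conjTranspose_onQubit (q : Fin n) (A : Matrix (Fin 2) (Fin 2) ℂ) :
    (onQubit q A)ᴴ = onQubit q Aᴴ := by
  ext a b
  simp only [onQubit, Matrix.conjTranspose_apply, Matrix.of_apply, eq_comm (a := b _)]
  split_ifs <;> simp

lemma cnot_mul_apply (c t : Fin n) (hct : c ≠ t) (M : QubitMatrix n) (a b : Bits n) :
    (cnot c t * M) a b = M (Function.update a t (a t + a c)) b := by
  have key : ∀ (x y : Bits n), x = Function.update y t (y t + y c) →
      y = Function.update x t (x t + x c) := by
    rintro x y rfl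
    funext j
    have : ∀ a b : Fin 2, a = a + b + b := by decide
    by_cases hj : j = t
    · subst hj; simpa [hct] using this _ _
    · simp [hj]
  simp only [Matrix.mul_apply, cnot, Matrix.of_apply]
  have h : ∀ y : Bits n, (a = Function.update y t (y t + y c)) ↔
    (y = Function.update a t (a t + a c)) := fun y => ⟨key _ _, key _ _⟩
  simp_rw [h]
  simp

lemma cnot_mul_self (c t : Fin n) (hct : c ≠ t) : cnot c t * cnot c t = 1 := by
  ext a b
  rw [cnot_mul_apply c t hct]
  simp only [cnot, Matrix.of_apply, Matrix.one_apply]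
  congr 1
  rw [eq_iff_iff]
  constructor
  · intro h
    have h1 : ∀ j, j ≠ t → a j = b j := fun j hj => by simpa [hj] using congrFun h j
    have h2 : a t + a c = b t + b c := by simpa using congrFun h t
    rw [h1 c hct] at h2
    funext j
    by_cases hj : j = t
    · subst hj; exact add_right_cancel h2
    · exact h1 j hj
  · rintro rfl; rfl

/-- The gate permutes basis states, so its adjoint is its inverse, and it is its own inverse. -/
lemma conjTranspose_cnot (c t : Fin n) (hct : c ≠ t) : (cnot c t)ᴴ = cnot c t := by
  have h : (cnot c t)ᴴ * cnot c t = (1 : QubitMatrix n) := by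
    ext a b
    simp only [Matrix.mul_apply, cnot, Matrix.conjTranspose_apply, Matrix.of_apply,
      Matrix.one_apply]
    have key : ∀ a b : Bits n, Function.update b t (b t + b c) = Function.update a t (a t + a c) ↔
        a = b := fun a b => by
      have := congrFun (congrFun (cnot_mul_self c t hct) a) b
      rw [cnot_mul_apply c t hct] at this
      simp only [cnot, Matrix.of_apply, Matrix.one_apply] at this
      rw [eq_comm (a := Function.update b _ _)]
      by_cases h : a = b
      · simp [h]
      · rw [if_neg h] at this
        simp only [h, iff_false]
        intro h'
        simp [h'] at this
    simp [key]
  calc (cnot c t)ᴴ = (cnot c t)ᴴ * (cnot c t * cnot c t) := by rw [cnot_mul_self c t hct, mul_one]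
    _ = cnot c t := by rw [← mul_assoc, h, one_mul]

lemma sqrt_two_inv_mul_self : ((Real.sqrt 2 : ℝ) : ℂ)⁻¹ * ((Real.sqrt 2 : ℝ) : ℂ)⁻¹ = 2⁻¹ := by
  rw [← mul_inv, ← Complex.ofReal_mul, Real.mul_self_sqrt (by norm_num)]
  simp

lemma hadamard_mul_self : hadamard * hadamard = 1 := by
  simp only [hadamard, Matrix.smul_mul, Matrix.mul_smul, smul_smul, sqrt_two_inv_mul_self]
  ext i j
  fin_cases i <;> fin_cases j <;> norm_num [Matrix.mul_apply, Fin.sum_univ_two]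

lemma conjTranspose_hadamard : hadamardᴴ = hadamard := by
  ext i j
  fin_cases i <;> fin_cases j <;> simp [hadamard]

lemma conjTranspose_phaseGate_mul_self : phaseGateᴴ * phaseGate = 1 := by
  ext i j
  fin_cases i <;> fin_cases j <;> simp [phaseGate, Matrix.mul_apply, Fin.sum_univ_two]

lemma phaseGate_pow_four : phaseGate ^ 4 = 1 := by
  simp only [phaseGate, pow_succ, pow_zero, one_mul]
  ext i j
  fin_cases i <;> fin_cases j <;> simp [Matrix.mul_apply, Fin.sum_univ_two]

lemma CliffordGate.toMatrix_mem_unitaryGroup (G : CliffordGate n) :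
    G.toMatrix ∈ Matrix.unitaryGroup (Bits n) ℂ := by
  rw [Matrix.mem_unitaryGroup_iff', Matrix.star_eq_conjTranspose]
  cases G with
  | H q =>
    simp [toMatrix, conjTranspose_onQubit, onQubit_mul, conjTranspose_hadamard, hadamard_mul_self,
      onQubit_one]
  | S q =>
    simp [toMatrix, conjTranspose_onQubit, onQubit_mul, conjTranspose_phaseGate_mul_self,
      onQubit_one]
  | CNOT c t hct => simp [toMatrix, conjTranspose_cnot c t hct, cnot_mul_self c t hct]

lemma CliffordGate.toMatrix_pow_four (G : CliffordGate n) : G.toMatrix ^ 4 = 1 := by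
  cases G with
  | H q =>
    have h : onQubit q hadamard ^ 2 = 1 := by
      rw [sq, onQubit_mul, hadamard_mul_self, onQubit_one]
    rw [toMatrix, show 4 = 2 * 2 from rfl, pow_mul, h, one_pow]
  | S q =>
    have h : ∀ k, onQubit q phaseGate ^ k = onQubit q (phaseGate ^ k) := fun k => by
      induction k with
      | zero => simp [onQubit_one]
      | succ k ih => rw [pow_succ, ih, onQubit_mul, pow_succ]
    rw [toMatrix, h, phaseGate_pow_four, onQubit_one]
  | CNOT c t hct =>
    have h : cnot c t ^ 2 = (1 : QubitMatrix n) := by rw [sq, cnot_mul_self c t hct]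
    rw [toMatrix, show 4 = 2 * 2 from rfl, pow_mul, h, one_pow]

/-- Both sides factor over qubits and agree away from `q`, so a 2 × 2 identity suffices. -/
lemma onQubit_mul_pauli (q : Fin n) (A : Matrix (Fin 2) (Fin 2) ℂ) (x z : Bits n) (x' z' : Fin 2)
    (ω : ℂ) (h : ∀ a b, A a (b + x q) * bitSign (z q) b =
      ω * (bitSign z' (a + x') * A (a + x') b)) :
    onQubit q A * pauli (x, z) =
      ω • (pauli (Function.update x q x', Function.update z q z') * onQubit q A) := by
  ext a b
  rw [mul_pauli_apply, Matrix.smul_apply, pauli_mul_apply, smul_eq_mul]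
  simp only [onQubit, Matrix.of_apply, Pi.add_apply, Function.update_self]
  have e : ∀ a b c : Fin 2, a = b + c ↔ a + c = b := by decide
  have hc : (∀ j, j ≠ q → a j = b j + x j) ↔
      (∀ j, j ≠ q → a j + Function.update x q x' j = b j) :=
    forall₂_congr fun j hj => by simp only [Function.update_of_ne hj]; exact e _ _ _
  by_cases hab : ∀ j, j ≠ q → a j = b j + x j
  · rw [if_pos hab, if_pos (hc.1 hab)]
    have hab' := hc.1 hab
    have hw : walsh (Function.update z q z') (a + Function.update x q x') * bitSign (z q) (b q) =
        walsh z b * bitSign z' (a q + x') := by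
      unfold walsh
      rw [← Finset.mul_prod_erase _ _ (Finset.mem_univ q),
        ← Finset.mul_prod_erase Finset.univ (fun j => bitSign (z j) (b j)) (Finset.mem_univ q)]
      have : ∏ j ∈ Finset.univ.erase q, bitSign (Function.update z q z' j)
          ((a + Function.update x q x') j) = ∏ j ∈ Finset.univ.erase q, bitSign (z j) (b j) :=
        Finset.prod_congr rfl fun j hj => by
          have hj := Finset.ne_of_mem_erase hj
          rw [Pi.add_apply, hab' j hj, Function.update_of_ne hj]
      rw [this]
      simp only [Pi.add_apply, Function.update_self]
      ring
    have h1 := h (a q) (b q)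
    have h2 := bitSign_mul_self (z q) (b q)
    have h3 := bitSign_mul_self z' (a q + x')
    -- Signs square to one, so multiplying by them takes the place of dividing.
    linear_combination (walsh z b * bitSign (z q) (b q)) * h1
      - (walsh z b * A (a q) (b q + x q)) * h2
      - (ω * A (a q + x') (b q) * bitSign (z q) (b q)) * hw
      + (ω * A (a q + x') (b q) * walsh (Function.update z q z') (a + Function.update x q x')) * h2
  · rw [if_neg hab, if_neg fun h => hab (hc.2 h)]
    simp

lemma onQubit_hadamard_mul_pauli (q : Fin n) (x z : Bits n) :
    onQubit q hadamard * pauli (x, z) = bitSign (x q) (z q) •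
      (pauli (Function.update x q (z q), Function.update z q (x q)) * onQubit q hadamard) := by
  apply onQubit_mul_pauli
  intro a b
  generalize x q = x
  generalize z q = z
  fin_cases a <;> fin_cases b <;> fin_cases x <;> fin_cases z <;> simp [hadamard, bitSign]

lemma onQubit_phaseGate_mul_pauli (q : Fin n) (x z : Bits n) :
    onQubit q phaseGate * pauli (x, z) = (Complex.I ^ (x q : ℕ)) •
      (pauli (x, Function.update z q (z q + x q)) * onQubit q phaseGate) := by
  have := onQubit_mul_pauli q phaseGate x z (x q) (z q + x q) (Complex.I ^ (x q : ℕ)) ?_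
  · simpa using this
  intro a b
  generalize x q = x
  generalize z q = z
  fin_cases a <;> fin_cases b <;> fin_cases x <;> fin_cases z <;> simp [phaseGate, bitSign]

lemma update_add_eq (x : Bits n) (q : Fin n) (k : Fin 2) :
    Function.update x q (x q + k) = x + Pi.single q k := by
  funext j
  by_cases hj : j = q
  · subst hj; simp
  · simp [hj]

lemma cnot_mul_pauli (c t : Fin n) (hct : c ≠ t) (x z : Bits n) :
    cnot c t * pauli (x, z) =
      pauli (Function.update x t (x t + x c), Function.update z c (z c + z t)) * cnot c t := by
  ext a b
  rw [mul_pauli_apply, pauli_mul_apply]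
  simp only [cnot, Matrix.of_apply, update_add_eq, Pi.add_apply]
  have hc : (a = b + x + Pi.single t (b c + x c)) ↔
      (a + (x + Pi.single t (x c)) = b + Pi.single t (b c)) := by
    have : b + x + (Pi.single t (b c) + Pi.single t (x c)) =
        b + Pi.single t (b c) + (x + Pi.single t (x c)) := by abel
    rw [Pi.single_add, this]
    exact bits_eq_add_iff.trans eq_comm
  by_cases h : a = b + x + Pi.single t (b c + x c)
  · rw [if_pos h, if_pos (hc.1 h), hc.1 h, walsh_add_left, walsh_add_right, walsh_add_right,
      walsh_single_right, walsh_single_left, walsh_single_left]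
    simp only [Pi.single_eq_of_ne hct, bitSign_zero_right]
    linear_combination (-walsh z b) * bitSign_mul_self (z t) (b c)
  · rw [if_neg h, if_neg fun h' => h (hc.2 h')]
    simp

/-! ### Finiteness of the set of stimuli -/

/-- The group of Clifford circuits (as a monoid of matrices). -/
def cliffordMonoid (n : ℕ) : Submonoid (QubitMatrix n) :=
  Submonoid.closure (Set.range CliffordGate.toMatrix)

lemma CliffordGate.exists_toMatrix_mul_pauli (G : CliffordGate n) (u : Bits n × Bits n) :
    ∃ (ω : ℂ) (u' : Bits n × Bits n), ω ^ 4 = 1 ∧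
      G.toMatrix * pauli u = ω • (pauli u' * G.toMatrix) := by
  obtain ⟨x, z⟩ := u
  cases G with
  | H q =>
    refine ⟨_, _, ?_, onQubit_hadamard_mul_pauli q x z⟩
    rw [show 4 = 2 * 2 from rfl, pow_mul, sq (bitSign _ _), bitSign_mul_self, one_pow]
  | S q =>
    refine ⟨_, _, ?_, onQubit_phaseGate_mul_pauli q x z⟩
    rw [pow_right_comm, Complex.I_pow_four, one_pow]
  | CNOT c t hct => exact ⟨1, _, one_pow _, by rw [one_smul]; exact cnot_mul_pauli c t hct x z⟩

/-- The unitary matrices with determinant a fourth root of unity that permute the Pauli operators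
up to phases by conjugation. -/
def pauliNormalizer (n : ℕ) : Set (QubitMatrix n) :=
  {M | M ∈ Matrix.unitaryGroup (Bits n) ℂ ∧ M.det ^ 4 = 1 ∧
    ∀ u, ∃ (ω : ℂ) (u' : Bits n × Bits n), ω ^ 4 = 1 ∧ M * pauli u = ω • (pauli u' * M)}

lemma cliffordMonoid_subset : (cliffordMonoid n : Set (QubitMatrix n)) ⊆ pauliNormalizer n := by
  intro M hM
  induction hM using Submonoid.closure_induction with
  | mem M hM =>
    obtain ⟨G, rfl⟩ := hM
    refine ⟨G.toMatrix_mem_unitaryGroup, ?_, G.exists_toMatrix_mul_pauli⟩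
    rw [← Matrix.det_pow, G.toMatrix_pow_four, Matrix.det_one]
  | one => exact ⟨one_mem _, by simp, fun u => ⟨1, u, by simp, by simp⟩⟩
  | mul A B _ _ hA hB =>
    refine ⟨mul_mem hA.1 hB.1, by rw [Matrix.det_mul, mul_pow, hA.2.1, hB.2.1, one_mul],
      fun u => ?_⟩
    obtain ⟨ω, v, hω, h⟩ := hB.2.2 u
    obtain ⟨ω', w, hω', h'⟩ := hA.2.2 v
    refine ⟨ω * ω', w, by rw [mul_pow, hω, hω', one_mul], ?_⟩
    rw [Matrix.mul_assoc, h, Matrix.mul_smul, ← Matrix.mul_assoc, h', Matrix.smul_mul, smul_smul,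
      Matrix.mul_assoc]

lemma finite_setOf_pow_eq_one {m : ℕ} (hm : 0 < m) : {z : ℂ | z ^ m = 1}.Finite := by
  refine ((Polynomial.nthRoots m (1 : ℂ)).toFinset.finite_toSet).subset fun z hz => ?_
  simpa [Polynomial.mem_nthRoots hm] using hz

/-- The Paulis span all matrices, so `N` is central. -/
lemma eq_smul_one_of_commute_pauli {N : QubitMatrix n} (h : ∀ u, N * pauli u = pauli u * N) :
    ∃ z : ℂ, N = z • 1 := by
  have h' : ∀ W, Commute W N := fun W => by
    rw [← sum_pauliCoeff_smul W]
    exact Commute.sum_left _ _ _ fun u _ => (Commute.smul_left (h u).symm _)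
  obtain ⟨z, hz⟩ := Matrix.mem_range_scalar_of_commute_single (M := N) fun i j _ => h' _
  exact ⟨z, by rw [← hz]; simp [Matrix.smul_one_eq_diagonal]⟩

/-- Conjugation on Paulis takes finitely many values, and it determines a unitary up to a scalar.
The determinant condition leaves finitely many scalars. -/
lemma finite_pauliNormalizer (n : ℕ) : (pauliNormalizer n).Finite := by
  let T : Set (QubitMatrix n) := Set.image2 (fun ω u => ω • pauli u) {z : ℂ | z ^ 4 = 1} Set.univ
  have hT : T.Finite := Set.Finite.image2 _ (finite_setOf_pow_eq_one (by norm_num)) Set.finite_univ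
  let Φ : QubitMatrix n → Bits n × Bits n → QubitMatrix n := fun M u => M * pauli u * Mᴴ
  refine Set.Finite.of_finite_fibers Φ ?_ ?_
  · refine (Set.Finite.pi (t := fun _ : Bits n × Bits n => T) fun _ => hT).subset ?_
    rintro _ ⟨M, ⟨hM, -, h⟩, rfl⟩ u -
    obtain ⟨ω, u', hω, hu⟩ := h u
    refine ⟨ω, hω, u', trivial, ?_⟩
    simp only [Φ]
    rw [hu, Matrix.smul_mul, Matrix.mul_assoc, ← Matrix.star_eq_conjTranspose,
      Matrix.mem_unitaryGroup_iff.1 hM, Matrix.mul_one]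
  · rintro _ ⟨M, ⟨hM, hdet, -⟩, rfl⟩
    -- The exponent comes from `det (z • M) = z ^ (2 ^ n) * det M`, raised to the fourth power.
    refine ((finite_setOf_pow_eq_one (m := 2 ^ n * 4) (by positivity)).image
      fun z => z • M).subset ?_
    rintro M' ⟨⟨hM', hdet', -⟩, h⟩
    have h1 : Mᴴ * M = 1 := Matrix.mem_unitaryGroup_iff'.1 hM
    have h2 : M * Mᴴ = 1 := Matrix.mem_unitaryGroup_iff.1 hM
    have h3 : M'ᴴ * M' = 1 := Matrix.mem_unitaryGroup_iff'.1 hM'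
    obtain ⟨z, hz⟩ : ∃ z : ℂ, Mᴴ * M' = z • 1 := eq_smul_one_of_commute_pauli fun u => by
      have hu : M' * pauli u * M'ᴴ = M * pauli u * Mᴴ := congrFun h u
      calc Mᴴ * M' * pauli u = Mᴴ * (M' * pauli u * M'ᴴ) * M' := by
            simp only [Matrix.mul_assoc, h3, Matrix.mul_one]
        _ = (Mᴴ * M) * pauli u * (Mᴴ * M') := by rw [hu]; simp only [Matrix.mul_assoc]
        _ = pauli u * (Mᴴ * M') := by rw [h1, Matrix.one_mul]
    have hM'z : M' = z • M := by
      calc M' = M * Mᴴ * M' := by rw [h2, Matrix.one_mul]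
        _ = z • M := by rw [Matrix.mul_assoc, hz, Matrix.mul_smul, Matrix.mul_one]
    refine ⟨z, ?_, hM'z.symm⟩
    rw [hM'z, Matrix.det_smul, mul_pow, hdet, mul_one, ← pow_mul] at hdet'
    simpa using hdet'

lemma CliffordLayer.toMatrix_mem (L : CliffordLayer n) : L.toMatrix ∈ cliffordMonoid n := by
  refine Submonoid.list_prod_mem _ fun M hM => ?_
  obtain ⟨G, -, rfl⟩ := List.mem_map.1 hM
  exact Submonoid.subset_closure ⟨G, rfl⟩

lemma exists_mem_cliffordMonoid_of_mem_globalStimuli {g : StateVector n}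
    (hg : g ∈ globalStimuli n) : ∃ M ∈ cliffordMonoid n, g = M *ᵥ ketZero n := by
  obtain ⟨l, -, G, rfl⟩ := hg
  refine ⟨_, Submonoid.list_prod_mem _ fun M hM => ?_, rfl⟩
  obtain ⟨i, rfl⟩ := (List.mem_ofFn' _ _).1 hM
  exact (G i).toMatrix_mem

lemma finite_globalStimuli (n : ℕ) : (globalStimuli n).Finite := by
  refine ((finite_pauliNormalizer n).image fun M => M *ᵥ ketZero n).subset fun g hg => ?_
  obtain ⟨M, hM, rfl⟩ := exists_mem_cliffordMonoid_of_mem_globalStimuli hg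
  exact ⟨M, cliffordMonoid_subset hM, rfl⟩

lemma globalStimuli_nonempty (n : ℕ) : (globalStimuli n).Nonempty :=
  ⟨_, 2, one_lt_two, fun _ => ⟨[], List.Pairwise.nil⟩, rfl⟩

/-- A single gate is a layer that can be prepended; `l > 1` is preserved. -/
lemma CliffordGate.mulVec_mem_globalStimuli (C : CliffordGate n) {g : StateVector n}
    (hg : g ∈ globalStimuli n) : C.toMatrix *ᵥ g ∈ globalStimuli n := by
  obtain ⟨l, hl, G, rfl⟩ := hg
  refine ⟨l + 1, by omega, Fin.cons ⟨[C], List.pairwise_singleton _ _⟩ G, ?_⟩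
  simp [List.ofFn_succ, CliffordLayer.toMatrix]

lemma star_dotProduct_mulVec_self {M : QubitMatrix n} (hM : M ∈ Matrix.unitaryGroup (Bits n) ℂ)
    (g : StateVector n) : star (M *ᵥ g) ⬝ᵥ (M *ᵥ g) = star g ⬝ᵥ g := by
  rw [Matrix.star_mulVec, Matrix.dotProduct_mulVec, Matrix.vecMul_vecMul,
    ← Matrix.star_eq_conjTranspose, Matrix.mem_unitaryGroup_iff'.1 hM, Matrix.vecMul_one]

lemma star_dotProduct_self_eq (g : StateVector n) :
    star g ⬝ᵥ g = ((∑ b, ‖g b‖ ^ 2 : ℝ) : ℂ) := by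
  simp_rw [Complex.ofReal_sum, sq_norm_eq_mul_star, dotProduct, Pi.star_apply, mul_comm]

lemma star_dotProduct_self_of_mem_globalStimuli {g : StateVector n} (hg : g ∈ globalStimuli n) :
    star g ⬝ᵥ g = 1 := by
  obtain ⟨M, hM, rfl⟩ := exists_mem_cliffordMonoid_of_mem_globalStimuli hg
  rw [star_dotProduct_mulVec_self (cliffordMonoid_subset hM).1]
  simp [ketZero]

/-- The global stimuli, as a finset. -/
noncomputable def stimuli (n : ℕ) : Finset (StateVector n) := (finite_globalStimuli n).toFinset

lemma mem_stimuli {g : StateVector n} : g ∈ stimuli n ↔ g ∈ globalStimuli n :=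
  Set.Finite.mem_toFinset _

/-- An injective self-map of a finite set is a permutation, so closure under inverse gates need not
be shown. -/
lemma sum_stimuli_mulVec (C : CliffordGate n) (f : StateVector n → ℂ) :
    ∑ g ∈ stimuli n, f (C.toMatrix *ᵥ g) = ∑ g ∈ stimuli n, f g := by
  classical
  have hinj : Function.Injective fun g : StateVector n => C.toMatrix *ᵥ g :=
    Function.LeftInverse.injective (g := fun g => C.toMatrixᴴ *ᵥ g) fun g => by
      simp only
      rw [Matrix.mulVec_mulVec, ← Matrix.star_eq_conjTranspose,
        Matrix.mem_unitaryGroup_iff'.1 C.toMatrix_mem_unitaryGroup, Matrix.one_mulVec]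
  have himg : (stimuli n).image (fun g => C.toMatrix *ᵥ g) = stimuli n := by
    refine Finset.eq_of_subset_of_card_le ?_ (Finset.card_image_of_injective _ hinj).ge
    intro _ hg'
    obtain ⟨g, hg, rfl⟩ := Finset.mem_image.1 hg'
    exact mem_stimuli.2 (C.mulVec_mem_globalStimuli (mem_stimuli.1 hg))
  conv_rhs => rw [← himg]
  rw [Finset.sum_image fun _ _ _ _ h => hinj h]

/-! ### Clifford invariance of Pauli correlations -/

/-- The unnormalized correlation of two Pauli operators over the global stimuli. -/
noncomputable def pauliCorrelation (u v : Bits n × Bits n) : ℂ :=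
  ∑ g ∈ stimuli n, expectation g (pauli u) * star (expectation g (pauli v))

lemma pauliCorrelation_eq_of_mul (C : CliffordGate n) {u v u' v' : Bits n × Bits n} {ω ω' : ℂ}
    (h : C.toMatrix * pauli u = ω • (pauli u' * C.toMatrix))
    (h' : C.toMatrix * pauli v = ω' • (pauli v' * C.toMatrix)) :
    pauliCorrelation u v = ω * star ω' * pauliCorrelation u' v' := by
  unfold pauliCorrelation
  rw [← sum_stimuli_mulVec C fun g => expectation g (pauli u') * star (expectation g (pauli v')),
    Finset.mul_sum]
  refine Finset.sum_congr rfl fun g _ => ?_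
  rw [expectation_mulVec C.toMatrix_mem_unitaryGroup h g,
    expectation_mulVec C.toMatrix_mem_unitaryGroup h' g, star_mul]
  ring

lemma pauliCorrelation_hadamard (q : Fin n) (u v : Bits n × Bits n) :
    pauliCorrelation u v = bitSign (u.1 q) (u.2 q) * bitSign (v.1 q) (v.2 q) *
      pauliCorrelation (Function.update u.1 q (u.2 q), Function.update u.2 q (u.1 q))
        (Function.update v.1 q (v.2 q), Function.update v.2 q (v.1 q)) := by
  have := pauliCorrelation_eq_of_mul (.H q) (onQubit_hadamard_mul_pauli q u.1 u.2)
    (onQubit_hadamard_mul_pauli q v.1 v.2)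
  rwa [star_bitSign] at this

lemma pauliCorrelation_phaseGate (q : Fin n) (u v : Bits n × Bits n) :
    pauliCorrelation u v = Complex.I ^ (u.1 q : ℕ) * star (Complex.I ^ (v.1 q : ℕ)) *
      pauliCorrelation (u.1, Function.update u.2 q (u.2 q + u.1 q))
        (v.1, Function.update v.2 q (v.2 q + v.1 q)) :=
  pauliCorrelation_eq_of_mul (.S q) (onQubit_phaseGate_mul_pauli q u.1 u.2)
    (onQubit_phaseGate_mul_pauli q v.1 v.2)

lemma pauliCorrelation_cnot {c t : Fin n} (hct : c ≠ t) (u v : Bits n × Bits n) :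
    pauliCorrelation u v =
      pauliCorrelation
        (Function.update u.1 t (u.1 t + u.1 c), Function.update u.2 c (u.2 c + u.2 t))
        (Function.update v.1 t (v.1 t + v.1 c), Function.update v.2 c (v.2 c + v.2 t)) := by
  have := pauliCorrelation_eq_of_mul (.CNOT c t hct) (ω := 1) (ω' := 1)
    ((cnot_mul_pauli c t hct u.1 u.2).trans (one_smul _ _).symm)
    ((cnot_mul_pauli c t hct v.1 v.2).trans (one_smul _ _).symm)
  simpa using this

/-- Two phase gates make `Z` on `q`, which fixes both labels but contributes the sign `-1` when
exactly one of them has an `X` there. The correlation is then its own negative. -/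
lemma pauliCorrelation_eq_zero_of_fst {u v : Bits n × Bits n} {q : Fin n} (h : u.1 q ≠ v.1 q) :
    pauliCorrelation u v = 0 := by
  have e : ∀ a b : Fin 2, a + b + b = a := by decide
  have h1 := pauliCorrelation_phaseGate q u v
  have h3 := pauliCorrelation_phaseGate q (u.1, Function.update u.2 q (u.2 q + u.1 q))
    (v.1, Function.update v.2 q (v.2 q + v.1 q))
  simp only [Function.update_self, Function.update_idem, e, Function.update_eq_self] at h3
  rw [h3] at h1
  have h2 : Complex.I ^ (u.1 q : ℕ) * star (Complex.I ^ (v.1 q : ℕ)) *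
      (Complex.I ^ (u.1 q : ℕ) * star (Complex.I ^ (v.1 q : ℕ))) = -1 := by
    revert h
    generalize u.1 q = a
    generalize v.1 q = b
    fin_cases a <;> fin_cases b <;> simp
  rw [← mul_assoc, h2] at h1
  exact self_eq_neg.1 (by simpa using h1)

lemma pauliCorrelation_eq_zero {u v : Bits n × Bits n} (h : u ≠ v) : pauliCorrelation u v = 0 := by
  by_cases h1 : u.1 = v.1
  · obtain ⟨q, hq⟩ := Function.ne_iff.1 fun h2 => h (Prod.ext h1 h2)
    -- A Hadamard gate turns a difference in `z` into a difference in `x`.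
    rw [pauliCorrelation_hadamard q, pauliCorrelation_eq_zero_of_fst (q := q), mul_zero]
    simpa using hq
  · obtain ⟨q, hq⟩ := Function.ne_iff.1 h1
    exact pauliCorrelation_eq_zero_of_fst hq

/-- A function on Pauli labels that is invariant under the action of the Clifford gates is constant
on nonzero labels. -/
lemma eq_of_clifford_invariant {α : Type*} (f : Bits n × Bits n → α)
    (hH : ∀ q x z, f (x, z) = f (Function.update x q (z q), Function.update z q (x q)))
    (hS : ∀ q x z, f (x, z) = f (x, Function.update z q (z q + x q)))
    (hC : ∀ c t, c ≠ t → ∀ x z, f (x, z) =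
      f (Function.update x t (x t + x c), Function.update z c (z c + z t)))
    {u : Bits n × Bits n} (hu : u ≠ 0) : f u = f (1, 0) := by
  have e : ∀ a : Fin 2, a ≠ 0 → a = 1 := by decide
  -- Qubit by qubit, `H` turns `Z` into `X` and `S` turns `XZ` into `X`, up to phase.
  have clear_z : ∀ (s : Finset (Fin n)) (x z : Bits n), (∀ q, q ∉ s → z q = 0) → (x, z) ≠ 0 →
      ∃ x' : Bits n, x' ≠ 0 ∧ f (x, z) = f (x', 0) := by
    intro s
    induction s using Finset.induction_on with
    | empty =>
      intro x z hz h
      obtain rfl : z = 0 := funext fun q => hz q (by simp)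
      exact ⟨x, fun hx => h (by rw [hx]; rfl), rfl⟩
    | insert q s hq ih =>
      intro x z hz h
      have supp : ∀ j, j ∉ s → Function.update z q 0 j = 0 := fun j hj => by
        by_cases hjq : j = q
        · subst hjq; simp
        · rw [Function.update_of_ne hjq]; exact hz j (by simp [hj, hjq])
      by_cases hzq : z q = 0
      · exact ih x z (fun j hj => by simpa [← hzq] using supp j hj) h
      replace hzq := e _ hzq
      by_cases hxq : x q = 0
      · rw [hH q, hxq, hzq]
        exact ih _ _ supp fun h0 => by
          simpa using congrFun (congrArg Prod.fst h0) q
      · replace hxq := e _ hxq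
        rw [hS q, hxq, hzq]
        exact ih _ _ supp fun h0 => by
          simpa [hxq] using congrFun (congrArg Prod.fst h0) q
  -- CNOTs controlled by `c` erase the other `X` factors; with `z = 0` nothing flows back to `c`.
  have clear_x : ∀ (c : Fin n) (s : Finset (Fin n)), c ∉ s → ∀ x : Bits n, x c = 1 →
      (∀ q, q ∉ s → q ≠ c → x q = 0) → f (x, 0) = f (Pi.single c 1, 0) := by
    intro c s
    induction s using Finset.induction_on with
    | empty =>
      intro _ x hc hx
      have : x = Pi.single c 1 := funext fun q => by
        by_cases hq : q = c
        · subst hq; simpa using hc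
        · simp [hq, hx q (by simp) hq]
      rw [this]
    | insert t s ht ih =>
      intro hcs x hc hx
      rw [Finset.mem_insert, not_or] at hcs
      by_cases hxt : x t = 0
      · refine ih hcs.2 x hc fun q hq hqc => ?_
        by_cases hqt : q = t
        · rw [hqt, hxt]
        · exact hx q (by simp [hq, hqt]) hqc
      · rw [hC c t hcs.1, e _ hxt, hc]
        simp only [Pi.zero_apply, add_zero]
        rw [show Function.update (0 : Bits n) c 0 = 0 from Function.update_eq_self c 0]
        refine ih hcs.2 _ (by rw [Function.update_of_ne hcs.1, hc]) fun q hq hqc => ?_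
        by_cases hqt : q = t
        · subst hqt; simp
        · rw [Function.update_of_ne hqt]; exact hx q (by simp [hq, hqt]) hqc
  obtain ⟨x, hx, hux⟩ := clear_z Finset.univ u.1 u.2 (by simp) hu
  obtain ⟨c, hc⟩ := Function.ne_iff.1 hx
  have h1 : ∀ y : Bits n, y c = 1 → f (y, 0) = f (Pi.single c 1, 0) := fun y hy =>
    clear_x c (Finset.univ.erase c) (by simp) y hy fun q hq hqc => absurd hq (by simp [hqc])
  -- The reference label `1` is all ones, so it reduces to `Pi.single c 1` for whichever `c` arose.
  rw [show u = (u.1, u.2) from rfl, hux, h1 x (e _ hc), h1 1 rfl]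

lemma pauliCorrelation_self_eq {u : Bits n × Bits n} (hu : u ≠ 0) :
    pauliCorrelation u u = pauliCorrelation ((1, 0) : Bits n × Bits n) (1, 0) := by
  refine eq_of_clifford_invariant (fun u => pauliCorrelation u u) (fun q x z => ?_)
    (fun q x z => ?_) (fun c t hct x z => pauliCorrelation_cnot hct _ _) hu
  · rw [pauliCorrelation_hadamard q, bitSign_mul_self, one_mul]
  · rw [pauliCorrelation_phaseGate q, ← sq_norm_eq_mul_star]
    simp

lemma pauliCorrelation_zero :
    pauliCorrelation (0 : Bits n × Bits n) 0 = (stimuli n).card := by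
  have h : ∀ g ∈ stimuli n, expectation g (pauli 0) * star (expectation g (pauli 0)) = 1 :=
    fun g hg => by
      rw [pauli_zero, expectation, Matrix.one_mulVec,
        star_dotProduct_self_of_mem_globalStimuli (mem_stimuli.1 hg)]
      simp
  rw [pauliCorrelation, Finset.sum_congr rfl h]
  simp

lemma sum_pauliCorrelation :
    ∑ u : Bits n × Bits n, pauliCorrelation u u = 2 ^ n * (stimuli n).card := by
  unfold pauliCorrelation
  rw [Finset.sum_comm]
  have h : ∀ g ∈ stimuli n, ∑ u, expectation g (pauli u) * star (expectation g (pauli u)) =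
      2 ^ n := fun g hg => by
    have h1 : ∑ b, ‖g b‖ ^ 2 = 1 := by
      have := star_dotProduct_self_of_mem_globalStimuli (mem_stimuli.1 hg)
      rw [star_dotProduct_self_eq] at this
      exact_mod_cast this
    have := sum_sq_norm_expectation_pauli g
    rw [h1] at this
    simp_rw [← sq_norm_eq_mul_star]
    rw [← Complex.ofReal_sum, this]
    simp
  rw [Finset.sum_congr rfl h]
  simp [mul_comm]

/-- Removing the identity term from the total leaves `4 ^ n - 1` equal terms with sum `(2 ^ n - 1) *
card`. Cancel `2 ^ n - 1`, which is nonzero because a nonzero label forces `n > 0`. -/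
lemma pauliCorrelation_self {u : Bits n × Bits n} (hu : u ≠ 0) :
    (2 ^ n + 1) * pauliCorrelation u u = (stimuli n).card := by
  have hn : (2 : ℂ) ^ n - 1 ≠ 0 := by
    rcases Nat.eq_zero_or_pos n with rfl | hn
    · exact absurd (Subsingleton.elim u 0) hu
    · have h : (2 : ℕ) ^ n ≠ 1 := (Nat.one_lt_two_pow hn.ne').ne'
      exact sub_ne_zero.2 (by exact_mod_cast h)
  have h := sum_pauliCorrelation (n := n)
  rw [← Finset.add_sum_erase _ _ (Finset.mem_univ 0), pauliCorrelation_zero,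
    Finset.sum_congr rfl fun v hv => (pauliCorrelation_self_eq (Finset.ne_of_mem_erase hv)).trans
      (pauliCorrelation_self_eq hu).symm] at h
  rw [Finset.sum_const, Finset.card_erase_of_mem (Finset.mem_univ _), nsmul_eq_mul,
    Nat.cast_sub (Finset.card_pos.2 ⟨0, Finset.mem_univ _⟩)] at h
  simp only [Finset.card_univ, Fintype.card_prod, Fintype.card_pi, Fintype.card_fin,
    Finset.prod_const, Nat.cast_mul, Nat.cast_pow, Nat.cast_ofNat, Nat.cast_one] at h
  apply mul_left_cancel₀ hn
  linear_combination h

/-! ### Second moment and trace bounds -/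

lemma sum_stimuli_sq_norm_expectation {W : QubitMatrix n}
    (hW : W ∈ Matrix.unitaryGroup (Bits n) ℂ) :
    ∑ g ∈ stimuli n, ‖expectation g W‖ ^ 2 =
      (stimuli n).card * ((1 + ‖W.trace‖ ^ 2 / 2 ^ n) / (2 ^ n + 1)) := by
  have hd : (2 : ℂ) ^ n + 1 ≠ 0 := by exact_mod_cast (Nat.succ_ne_zero (2 ^ n))
  have h1 : ((∑ g ∈ stimuli n, ‖expectation g W‖ ^ 2 : ℝ) : ℂ) =
      ∑ u, ((‖pauliCoeff W u‖ ^ 2 : ℝ) : ℂ) * pauliCorrelation u u := by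
    simp_rw [Complex.ofReal_sum, sq_norm_eq_mul_star, expectation_eq_sum _ W, star_sum,
      Finset.sum_mul_sum]
    rw [Finset.sum_comm]
    refine Finset.sum_congr rfl fun u _ => ?_
    rw [Finset.sum_comm]
    have h2 : ∀ v, ∑ g ∈ stimuli n, pauliCoeff W u * expectation g (pauli u) *
        star (pauliCoeff W v * expectation g (pauli v)) =
        pauliCoeff W u * star (pauliCoeff W v) * pauliCorrelation u v := fun v => by
      rw [pauliCorrelation, Finset.mul_sum]
      exact Finset.sum_congr rfl fun g _ => by rw [star_mul]; ring
    simp_rw [h2]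
    rw [Finset.sum_eq_single u (fun v _ hv => by
      rw [pauliCorrelation_eq_zero hv.symm, mul_zero]) (by simp)]
  have h3 := sum_sq_norm_pauliCoeff_of_mem_unitaryGroup hW
  have h4 : ((∑ u, ‖pauliCoeff W u‖ ^ 2 : ℝ) : ℂ) = 1 := by rw [h3]; simp
  rw [Complex.ofReal_sum, ← Finset.add_sum_erase _ _ (Finset.mem_univ 0)] at h4
  rw [← Finset.add_sum_erase _ _ (Finset.mem_univ 0), pauliCorrelation_zero] at h1
  have h5 : ∀ u ∈ Finset.univ.erase (0 : Bits n × Bits n),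
      ((‖pauliCoeff W u‖ ^ 2 : ℝ) : ℂ) * pauliCorrelation u u =
      ((‖pauliCoeff W u‖ ^ 2 : ℝ) : ℂ) * ((stimuli n).card / (2 ^ n + 1)) := fun u hu => by
    rw [← pauliCorrelation_self (Finset.ne_of_mem_erase hu), mul_div_cancel_left₀ _ hd]
  -- The non-identity Paulis carry total weight `1 - |c 0|²`.
  rw [Finset.sum_congr rfl h5, ← Finset.sum_mul, eq_sub_of_add_eq' h4, pauliCoeff_zero] at h1
  apply Complex.ofReal_injective
  rw [h1]
  simp
  field_simp
  ring

lemma sq_norm_trace_le {W : QubitMatrix n} (hW : W ∈ Matrix.unitaryGroup (Bits n) ℂ) :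
    ‖W.trace‖ ^ 2 ≤ (2 ^ n) ^ 2 := by
  have h := sum_sq_norm_pauliCoeff_of_mem_unitaryGroup hW
  have h1 : ‖pauliCoeff W 0‖ ^ 2 ≤ 1 := h ▸
    Finset.single_le_sum (f := fun u => ‖pauliCoeff W u‖ ^ 2) (fun _ _ => sq_nonneg _)
      (Finset.mem_univ 0)
  rw [pauliCoeff_zero, norm_mul, mul_pow] at h1
  have h2 : (0 : ℝ) < 2 ^ n := by positivity
  simp only [norm_inv, norm_pow, Complex.norm_ofNat, inv_pow] at h1
  rwa [inv_mul_le_iff₀ (by positivity), mul_one] at h1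

/-- A maximal trace uses up the whole unit Pauli weight at the identity, so every other coefficient
vanishes. -/
lemma sq_norm_trace_eq_iff {W : QubitMatrix n} (hW : W ∈ Matrix.unitaryGroup (Bits n) ℂ) :
    ‖W.trace‖ ^ 2 = (2 ^ n) ^ 2 ↔ ∃ z : ℂ, ‖z‖ = 1 ∧ W = z • 1 := by
  constructor
  · intro ht
    have h := sum_sq_norm_pauliCoeff_of_mem_unitaryGroup hW
    have h0 : ‖pauliCoeff W 0‖ ^ 2 = 1 := by
      rw [pauliCoeff_zero, norm_mul, mul_pow, ht]
      simp
    rw [← Finset.add_sum_erase _ _ (Finset.mem_univ 0), h0, add_eq_left,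
      Finset.sum_eq_zero_iff_of_nonneg fun _ _ => sq_nonneg _] at h
    refine ⟨pauliCoeff W 0, (pow_eq_one_iff_of_nonneg (norm_nonneg _) two_ne_zero).1 h0, ?_⟩
    conv_lhs => rw [← sum_pauliCoeff_smul W]
    rw [Finset.sum_eq_single 0, pauli_zero]
    · intro u _ hu
      have := h u (by simp [hu])
      rw [norm_eq_zero.1 (pow_eq_zero_iff two_ne_zero |>.1 this), zero_smul]
    · simp
  · rintro ⟨z, hz, rfl⟩
    simp [hz]

lemma fidelity_mulVec (U V : QubitMatrix n) (g : StateVector n) :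
    fidelity (U *ᵥ g) (V *ᵥ g) = ‖expectation g (Uᴴ * V)‖ ^ 2 := by
  rw [fidelity, expectation, Matrix.star_mulVec, ← Matrix.dotProduct_mulVec, Matrix.mulVec_mulVec]

lemma conjTranspose_mul_mem_unitaryGroup {U V : QubitMatrix n}
    (hU : U ∈ Matrix.unitaryGroup (Bits n) ℂ) (hV : V ∈ Matrix.unitaryGroup (Bits n) ℂ) :
    Uᴴ * V ∈ Matrix.unitaryGroup (Bits n) ℂ :=
  mul_mem (Unitary.star_mem hU) hV

/-! ### The uniform measure and the average fidelity -/

lemma integrableOn_count_finset {α : Type*} [MeasurableSpace α] [MeasurableSingletonClass α]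
    (s : Finset α) (f : α → ℝ) : MeasureTheory.IntegrableOn f s MeasureTheory.Measure.count := by
  rw [← (s : Set α).biUnion_of_singleton]
  simp [MeasureTheory.integrableOn_finset_iUnion]

lemma integral_stimulusMeasure (f : StateVector n → ℝ) :
    ∫ g, f g ∂(stimulusMeasure n) = ((stimuli n).card : ℝ)⁻¹ * ∑ g ∈ stimuli n, f g := by
  have h : globalStimuli n = (stimuli n : Set (StateVector n)) := by ext; simp [mem_stimuli]
  have hi : MeasureTheory.IntegrableOn f (stimuli n) MeasureTheory.Measure.count :=
    integrableOn_count_finset _ _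
  rw [stimulusMeasure, ProbabilityTheory.uniformOn, ProbabilityTheory.cond,
    MeasureTheory.integral_smul_measure, h, MeasureTheory.setIntegral_finset _ hi]
  simp [MeasureTheory.Measure.real, MeasureTheory.Measure.count_apply_finset]

lemma integrable_stimulusMeasure (f : StateVector n → ℝ) :
    MeasureTheory.Integrable f (stimulusMeasure n) := by
  have h : globalStimuli n = (stimuli n : Set (StateVector n)) := by ext; simp [mem_stimuli]
  have hi : MeasureTheory.IntegrableOn f (stimuli n) MeasureTheory.Measure.count :=
    integrableOn_count_finset _ _
  rw [stimulusMeasure, ProbabilityTheory.uniformOn, ProbabilityTheory.cond]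
  refine MeasureTheory.Integrable.smul_measure (by rwa [h]) ?_
  -- The normalizing factor, an inverse cardinality, is finite because the set is nonempty.
  simpa using (globalStimuli_nonempty n).ne_empty

lemma correctlyRealizes_iff {U V : QubitMatrix n} (hU : U ∈ Matrix.unitaryGroup (Bits n) ℂ) :
    CorrectlyRealizes V U ↔ ∃ z : ℂ, ‖z‖ = 1 ∧ Uᴴ * V = z • 1 := by
  refine exists_congr fun z => and_congr_right fun _ => ⟨?_, fun h => ?_⟩
  · rintro rfl
    rw [Matrix.mul_smul, ← Matrix.star_eq_conjTranspose, Matrix.mem_unitaryGroup_iff'.1 hU]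
  · calc V = U * Uᴴ * V := by
          rw [← Matrix.star_eq_conjTranspose, Matrix.mem_unitaryGroup_iff.1 hU, Matrix.one_mul]
      _ = z • U := by rw [Matrix.mul_assoc, h, Matrix.mul_smul, Matrix.mul_one]

lemma avgFidelity_eq_one_iff {U V : QubitMatrix n} (hU : U ∈ Matrix.unitaryGroup (Bits n) ℂ)
    (hV : V ∈ Matrix.unitaryGroup (Bits n) ℂ) :
    avgFidelity U V = 1 ↔ CorrectlyRealizes V U := by
  rw [correctlyRealizes_iff hU, ← sq_norm_trace_eq_iff (conjTranspose_mul_mem_unitaryGroup hU hV),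
    avgFidelity, div_eq_one_iff_eq (by positivity), add_comm, add_left_inj,
    div_eq_iff (by positivity), ← sq]

lemma avgFidelity_le_one {U V : QubitMatrix n} (hU : U ∈ Matrix.unitaryGroup (Bits n) ℂ)
    (hV : V ∈ Matrix.unitaryGroup (Bits n) ℂ) : avgFidelity U V ≤ 1 := by
  rw [avgFidelity, div_le_one (by positivity), add_comm, add_le_add_iff_right,
    div_le_iff₀ (by positivity), ← sq]
  exact sq_norm_trace_le (conjTranspose_mul_mem_unitaryGroup hU hV)

lemma integral_fidelity {U V : QubitMatrix n} (hU : U ∈ Matrix.unitaryGroup (Bits n) ℂ)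
    (hV : V ∈ Matrix.unitaryGroup (Bits n) ℂ) :
    ∫ g, fidelity (U *ᵥ g) (V *ᵥ g) ∂(stimulusMeasure n) = avgFidelity U V := by
  have hc : ((stimuli n).card : ℝ) ≠ 0 := by
    obtain ⟨g, hg⟩ := globalStimuli_nonempty n
    exact Nat.cast_ne_zero.2 (Finset.card_ne_zero_of_mem (mem_stimuli.2 hg))
  rw [integral_stimulusMeasure]
  simp_rw [fidelity_mulVec]
  rw [sum_stimuli_sq_norm_expectation (conjTranspose_mul_mem_unitaryGroup hU hV),
    inv_mul_cancel_left₀ hc, avgFidelity]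

lemma isProbabilityMeasure_stimulusMeasure (n : ℕ) :
    MeasureTheory.IsProbabilityMeasure (stimulusMeasure n) :=
  ProbabilityTheory.isProbabilityMeasure_uniformOn (finite_globalStimuli n)
    (globalStimuli_nonempty n)

end QuantumStimuli

theorem corollary1 (n : ℕ) (U V : QuantumStimuli.QubitMatrix n)
    (hU : U ∈ Matrix.unitaryGroup (QuantumStimuli.Bits n) ℂ)
    (hV : V ∈ Matrix.unitaryGroup (QuantumStimuli.Bits n) ℂ) :
    (QuantumStimuli.globalStimuli n).Finite ∧
    MeasureTheory.IsProbabilityMeasure (QuantumStimuli.stimulusMeasure n) ∧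
    (∫ g, QuantumStimuli.fidelity (U *ᵥ g) (V *ᵥ g) ∂(QuantumStimuli.stimulusMeasure n))
      = QuantumStimuli.avgFidelity U V ∧
    (QuantumStimuli.stimulusMeasure n).real
        {g | QuantumStimuli.fidelity (U *ᵥ g) (V *ᵥ g) = 1}
      ≤ QuantumStimuli.avgFidelity U V ∧
    (QuantumStimuli.avgFidelity U V = 1 ↔ QuantumStimuli.CorrectlyRealizes V U) ∧
    (¬ QuantumStimuli.CorrectlyRealizes V U → QuantumStimuli.avgFidelity U V < 1) := by
  have := QuantumStimuli.isProbabilityMeasure_stimulusMeasure n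
  refine ⟨QuantumStimuli.finite_globalStimuli n, this, QuantumStimuli.integral_fidelity hU hV, ?_,
    QuantumStimuli.avgFidelity_eq_one_iff hU hV, fun h =>
      (QuantumStimuli.avgFidelity_le_one hU hV).lt_of_ne fun h' =>
        h ((QuantumStimuli.avgFidelity_eq_one_iff hU hV).1 h')⟩
  rw [← QuantumStimuli.integral_fidelity hU hV]
  -- Markov at level `1`: fidelity equal to one lies in the event of fidelity at least one.
  have markov := MeasureTheory.mul_meas_ge_le_integral_of_nonneg
    (f := fun g => QuantumStimuli.fidelity (U *ᵥ g) (V *ᵥ g))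
    (μ := QuantumStimuli.stimulusMeasure n) (Filter.Eventually.of_forall fun _ => sq_nonneg _)
    (QuantumStimuli.integrable_stimulusMeasure _) 1
  rw [one_mul] at markov
  exact (MeasureTheory.measureReal_mono fun g hg => (hg : _ = (1 : ℝ)).ge).trans markov
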